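/- For $N\ge 1$ let $P_N^Q$ be the law of the eigenvalues $(z_1,\dots,z_N)\in\mathbb C^N$ of Ginibre's Gaussian quaternion ensemble, that is, the probability measure on $\mathbb C^N$ given by $$dP_N^Q(z_1,\dots,z_N)=\frac1{Z_N^Q}\prod_{1\le \ell<k\le N}|z_\ell-z_k|^2\,|z_\ell-\bar z_k|^2\prod_{k=1}^N|z_k-\bar z_k|^2\prod_{k=1}^N e^{-2N|z_k|^2}\,d\Re(z_k)\,d\Im(z_k),$$ where $Z_N^Q\in(0,\infty)$ is the normalizing constant. For $0\le a\le b$ let $\#\mathcal I[a,b]=\#\{k : a\le |z_k|\le b\}$ be the radial number statistic. Let $[a_N,b_N]\subset[0,1]$ be intervals, possibly depending on $N$, such that $b_N$ stays bounded away from $0$ (that is, for some $\varepsilon>0$ one has $0\le a_N$ and $\varepsilon\le b_N\le 1$ for all large $N$), and suppose that $N(b_N-a_N)\to\infty$ as $N\to\infty$. Then, with mean and variance taken under $P_N^Q$, $$\frac{\#\mathcal I[a_N,b_N]-E[\#\mathcal I[a_N,b_N]]}{\sqrt{\mathrm{Var}(\#\mathcal I[a_N,b_N])}}$$ converges in distribution,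 as $N\to\infty$, to a Gaussian random variable of mean zero and variance one. -/

import Mathlib

open MeasureTheory ProbabilityTheory Filter Topology

namespace QuaternionGinibre

/-- The unnormalized joint eigenvalue density, with respect to Lebesgue measure on `ℂ ^ N`,
`∏_{l < k} |z_l - z_k|² |z_l - conj z_k|² · ∏_k |z_k - conj z_k|² · ∏_k exp (-2 N |z_k|²)`. -/
noncomputable def weight (N : ℕ) (z : Fin N → ℂ) : ℝ :=
  (∏ k, ∏ l ∈ Finset.Iio k,
      ‖z l - z k‖ ^ 2 * ‖z l - (starRingEnd ℂ) (z k)‖ ^ 2) *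
    (∏ k, ‖z k - (starRingEnd ℂ) (z k)‖ ^ 2) *
    ∏ k, Real.exp (-2 * (N : ℝ) * ‖z k‖ ^ 2)

/-- The normalizing constant. -/
noncomputable def partitionFunction (N : ℕ) : ENNReal :=
  ∫⁻ z : Fin N → ℂ, ENNReal.ofReal (weight N z)

/-- The eigenvalue law of the quaternion Gaussian ensemble: the probability measure on `ℂ ^ N`
whose density with respect to Lebesgue measure is proportional to `weight N`. -/
noncomputable def law (N : ℕ) : Measure (Fin N → ℂ) :=
  (partitionFunction N)⁻¹ •
    (volume : Measure (Fin N → ℂ)).withDensity (fun z => ENNReal.ofReal (weight N z))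

/-- The linear statistic `X(f) = ∑_k f (z_k)`. -/
noncomputable def linearStatistic {N : ℕ} (f : ℂ → ℝ) (z : Fin N → ℂ) : ℝ :=
  ∑ k, f (z k)

/-- The radial number statistic: the number of indices `k` with `a ≤ |z_k| ≤ b`. -/
noncomputable def radialCount {N : ℕ} (a b : ℝ) (z : Fin N → ℂ) : ℝ :=
  linearStatistic (Set.indicator {w : ℂ | ‖w‖ ∈ Set.Icc a b} 1) z

/-- The normalized radial number statistic `(#I - E #I) / √(Var #I)`. -/
noncomputable def normalizedRadialCount (N : ℕ) (a b : ℝ) (z : Fin N → ℂ) : ℝ :=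
  (radialCount a b z - ∫ y, radialCount a b y ∂(law N)) /
    Real.sqrt (variance (radialCount a b) (law N))

theorem continuous_weight (N : ℕ) : Continuous (weight N) := by
  unfold weight
  fun_prop

theorem weight_nonneg (N : ℕ) (z : Fin N → ℂ) : 0 ≤ weight N z := by
  unfold weight
  positivity

theorem integrable_factor (M : ℕ) {c : ℝ} (hc : 0 < c) :
    Integrable (fun z : ℂ => (1 + ‖z‖) ^ M * Real.exp (-c * ‖z‖ ^ 2)) := by
  have hg : Integrable (fun z : ℂ => Real.exp (-(c / 2) * ‖z‖ ^ 2)) := by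
    have h := (GaussianFourier.integrable_cexp_neg_mul_sq_norm_add (V := ℂ)
      (b := ((c / 2 : ℝ) : ℂ)) (by simpa using hc) 0 0).norm
    refine h.congr (Eventually.of_forall fun z => ?_)
    simp only [Complex.norm_exp]
    congr 1
    norm_cast
    simp
  refine (hg.const_mul (M.factorial * Real.exp (1 + 1 / (2 * c)))).mono'
    (by fun_prop) (Eventually.of_forall fun z => ?_)
  have h1 := Real.pow_div_factorial_le_exp (1 + ‖z‖) (by positivity) M
  have hf : (0 : ℝ) < M.factorial := by positivity
  rw [div_le_iff₀ hf] at h1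
  rw [Real.norm_of_nonneg (by positivity)]
  have h2 : 1 + ‖z‖ - c * ‖z‖ ^ 2 ≤ 1 + 1 / (2 * c) - c / 2 * ‖z‖ ^ 2 := by
    have : 1 / (2 * c) - ‖z‖ + c / 2 * ‖z‖ ^ 2 = (c * ‖z‖ - 1) ^ 2 / (2 * c) := by
      field_simp
      ring
    have : 0 ≤ (c * ‖z‖ - 1) ^ 2 / (2 * c) := by positivity
    linarith
  calc (1 + ‖z‖) ^ M * Real.exp (-c * ‖z‖ ^ 2)
      ≤ (Real.exp (1 + ‖z‖) * M.factorial) * Real.exp (-c * ‖z‖ ^ 2) := by gcongr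
    _ = M.factorial * Real.exp (1 + ‖z‖ - c * ‖z‖ ^ 2) := by
        rw [show 1 + ‖z‖ - c * ‖z‖ ^ 2 = (1 + ‖z‖) + (-c * ‖z‖ ^ 2) by ring,
          Real.exp_add (1 + ‖z‖)]
        ring
    _ ≤ M.factorial * Real.exp (1 + 1 / (2 * c) - c / 2 * ‖z‖ ^ 2) := by gcongr
    _ = M.factorial * Real.exp (1 + 1 / (2 * c)) * Real.exp (-(c / 2) * ‖z‖ ^ 2) := by
        rw [show 1 + 1 / (2 * c) - c / 2 * ‖z‖ ^ 2
          = (1 + 1 / (2 * c)) + (-(c / 2) * ‖z‖ ^ 2) by ring, Real.exp_add]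
        ring

theorem integrable_weight (N : ℕ) : Integrable (weight N) := by
  obtain ⟨M, hM⟩ : ∃ M : ℕ, ∀ z : Fin N → ℂ,
      (∏ k, ∏ l ∈ Finset.Iio k, ‖z l - z k‖ ^ 2 * ‖z l - (starRingEnd ℂ) (z k)‖ ^ 2) *
        (∏ k, ‖z k - (starRingEnd ℂ) (z k)‖ ^ 2) ≤ (∏ k, (1 + ‖z k‖)) ^ M := by
    refine ⟨(∑ k : Fin N, ∑ _l ∈ Finset.Iio k, 8) + ∑ _k : Fin N, 4, fun z => ?_⟩
    set S : ℝ := ∏ k, (1 + ‖z k‖) with hS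
    have h1 : ∀ k, 1 + ‖z k‖ ≤ S := fun k => by
      rw [hS, ← Finset.mul_prod_erase _ _ (Finset.mem_univ k)]
      refine le_mul_of_one_le_right (by positivity) ?_
      calc (1 : ℝ) = ∏ _j ∈ Finset.univ.erase k, (1 : ℝ) := by simp
        _ ≤ _ := Finset.prod_le_prod (fun _ _ => zero_le_one) (fun i _ => by simp)
    have hd : ∀ k l, ‖z l - z k‖ ≤ S ^ 2 := fun k l => by
      have := norm_sub_le (z l) (z k)
      nlinarith [h1 k, h1 l, norm_nonneg (z k), norm_nonneg (z l)]
    have hd' : ∀ k l, ‖z l - (starRingEnd ℂ) (z k)‖ ≤ S ^ 2 := fun k l => by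
      have := norm_sub_le (z l) ((starRingEnd ℂ) (z k))
      rw [RCLike.norm_conj] at this
      nlinarith [h1 k, h1 l, norm_nonneg (z k), norm_nonneg (z l)]
    rw [pow_add]
    simp only [← Finset.prod_pow_eq_pow_sum]
    gcongr with k _ l _ k _
    · calc ‖z l - z k‖ ^ 2 * ‖z l - (starRingEnd ℂ) (z k)‖ ^ 2
          ≤ (S ^ 2) ^ 2 * (S ^ 2) ^ 2 := by gcongr <;> simp [hd, hd']
        _ = S ^ 8 := by ring
    · calc ‖z k - (starRingEnd ℂ) (z k)‖ ^ 2 ≤ (S ^ 2) ^ 2 := by gcongr; exact hd' k k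
        _ = S ^ 4 := by ring
  rcases Nat.eq_zero_or_pos N with rfl | hN
  · simp [Integrable.of_finite]
  have hc : (0 : ℝ) < 2 * N := by positivity
  refine (Integrable.fintype_prod (μ := fun _ => volume)
    (fun _ : Fin N => integrable_factor M hc)).mono'
    (continuous_weight N).aestronglyMeasurable (Eventually.of_forall fun z => ?_)
  rw [Real.norm_of_nonneg (weight_nonneg N z), Finset.prod_mul_distrib, Finset.prod_pow]
  unfold weight
  simp only [← neg_mul]
  gcongr
  exact hM z

theorem partitionFunction_ne_top (N : ℕ) : partitionFunction N ≠ ⊤ :=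
  (integrable_weight N).lintegral_lt_top.ne

theorem partitionFunction_ne_zero (N : ℕ) : partitionFunction N ≠ 0 := by
  intro h
  have hcont : Continuous (fun z : Fin N → ℂ => ENNReal.ofReal (weight N z)) :=
    ENNReal.continuous_ofReal.comp (continuous_weight N)
  rw [partitionFunction, lintegral_eq_zero_iff hcont.measurable] at h
  have h0 := (Continuous.ae_eq_iff_eq (μ := volume) hcont continuous_zero).1 h
  have h1 := congrFun h0 (fun k : Fin N => (((k : ℕ) + 1 : ℝ) : ℂ) * Complex.I)
  simp only [Pi.zero_apply, ENNReal.ofReal_eq_zero] at h1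
  refine absurd h1 (not_le.2 ?_)
  unfold weight
  have hp : ∀ k l : Fin N, (((l : ℕ) + 1 : ℝ) : ℂ) * Complex.I
      - (starRingEnd ℂ) ((((k : ℕ) + 1 : ℝ) : ℂ) * Complex.I) ≠ 0 := by
    intro k l hkl
    have := congrArg Complex.im hkl
    simp at this
    have hk : (0 : ℝ) ≤ (k : ℕ) := by positivity
    have hl : (0 : ℝ) ≤ (l : ℕ) := by positivity
    linarith
  refine mul_pos (mul_pos ?_ ?_) (by positivity)
  · refine Finset.prod_pos fun k _ => Finset.prod_pos fun l hl => ?_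
    have hlk : (l : ℕ) < k := Fin.lt_def.1 (Finset.mem_Iio.1 hl)
    have h2 : (((l : ℕ) + 1 : ℝ) : ℂ) * Complex.I - (((k : ℕ) + 1 : ℝ) : ℂ) * Complex.I ≠ 0 := by
      intro hkl
      have := congrArg Complex.im hkl
      simp [sub_eq_zero] at this
      omega
    exact mul_pos (pow_pos (norm_pos_iff.2 h2) 2) (pow_pos (norm_pos_iff.2 (hp k l)) 2)
  · exact Finset.prod_pos fun k _ => pow_pos (norm_pos_iff.2 (hp k k)) 2

instance isProbabilityMeasure_law (N : ℕ) : IsProbabilityMeasure (law N) := by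
  constructor
  rw [law, Measure.smul_apply, withDensity_apply _ MeasurableSet.univ, Measure.restrict_univ,
    smul_eq_mul]
  exact ENNReal.inv_mul_cancel (partitionFunction_ne_zero N) (partitionFunction_ne_top N)

end QuaternionGinibre

/- The density is a product of a `2N`-dimensional Vandermonde determinant and one-particle factors.
Expanding the determinant and integrating out the angles leaves, for every product of radial
functions, a constant times a product of one-dimensional radial integrals, so the moduli are
distributed, up to order, like independent square roots of Gamma variables (Kostlan's theorem).
Hence the radial count has the law of a sum of independent indicators. By Stirling's formula the
Gamma densities are large enough in a window of width of order `√(N b²)` around `2 N b²` for the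
variance of this sum to diverge, and Lyapunov's argument gives the central limit theorem. -/

section CentralLimit

theorem norm_prod_sub_prod_le {R ι : Type*} [NormedCommRing R] [NormOneClass R] (s : Finset ι)
    {f g : ι → R} (hf : ∀ i, ‖f i‖ ≤ 1) (hg : ∀ i, ‖g i‖ ≤ 1) :
    ‖∏ i ∈ s, f i - ∏ i ∈ s, g i‖ ≤ ∑ i ∈ s, ‖f i - g i‖ := by
  classical
  induction s using Finset.induction_on with
  | empty => simp
  | insert i s hi ih =>
    have hprod : ‖∏ j ∈ s, f j‖ ≤ 1 :=
      (s.norm_prod_le f).trans (Finset.prod_le_one (fun _ _ => norm_nonneg _) fun j _ => hf j)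
    rw [Finset.prod_insert hi, Finset.prod_insert hi, Finset.sum_insert hi]
    calc ‖f i * ∏ j ∈ s, f j - g i * ∏ j ∈ s, g j‖
        = ‖(f i - g i) * ∏ j ∈ s, f j + g i * (∏ j ∈ s, f j - ∏ j ∈ s, g j)‖ := by ring_nf
      _ ≤ ‖f i - g i‖ * ‖∏ j ∈ s, f j‖ + ‖g i‖ * ‖∏ j ∈ s, f j - ∏ j ∈ s, g j‖ :=
          (norm_add_le _ _).trans (add_le_add (norm_mul_le _ _) (norm_mul_le _ _))
      _ ≤ ‖f i - g i‖ * 1 + 1 * ∑ j ∈ s, ‖f j - g j‖ := by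
          gcongr
          exact hg i
      _ = ‖f i - g i‖ + ∑ j ∈ s, ‖f j - g j‖ := by ring

theorem norm_exp_mul_I_sub_le {x : ℝ} (hx : |x| ≤ 1) :
    ‖Complex.exp (x * Complex.I) - (1 + x * Complex.I - x ^ 2 / 2)‖ ≤ |x| ^ 3 := by
  have hnorm : ‖(x : ℂ) * Complex.I‖ = |x| := by simp
  have hsum : ∑ m ∈ Finset.range 3, ((x : ℂ) * Complex.I) ^ m / m.factorial =
      1 + x * Complex.I - x ^ 2 / 2 := by
    simp only [Finset.sum_range_succ, Finset.sum_range_zero, Nat.factorial, mul_pow, Complex.I_sq]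
    push_cast
    ring
  have hexp := Complex.exp_bound (x := x * Complex.I) (by rwa [hnorm]) (n := 3) (by norm_num)
  rw [hsum, hnorm] at hexp
  refine hexp.trans (mul_le_of_le_one_right (by positivity) ?_)
  norm_num [Nat.factorial]

variable {Ω : Type*} {mΩ : MeasurableSpace Ω} {P : Measure Ω} [IsProbabilityMeasure P] {K θ : ℝ}

theorem charFun_map_sub_eq_integral_of_integral_eq_zero {X : Ω → ℝ} (hX : MemLp X 2 P)
    (hmean : P[X] = 0) (θ : ℝ) :
    charFun (P.map X) θ - (1 - Var[X; P] * θ ^ 2 / 2 : ℝ) =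
      ∫ ω, (Complex.exp ((θ * X ω : ℝ) * Complex.I) -
        ((1 - (θ * X ω) ^ 2 / 2 : ℝ) + (θ * X ω : ℝ) * Complex.I)) ∂P := by
  have hmeas : AEMeasurable X P := hX.aestronglyMeasurable.aemeasurable
  have hexp : Integrable (fun ω => Complex.exp ((θ * X ω : ℝ) * Complex.I)) P :=
    .of_bound (by fun_prop) 1 (by simp only [Complex.norm_exp_ofReal_mul_I, le_refl]; simp)
  have hlin : Integrable (fun ω => θ * X ω) P := (hX.integrable one_le_two).const_mul θ
  have hsq : Integrable (fun ω => θ ^ 2 * X ω ^ 2 / 2) P :=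
    (hX.integrable_sq.const_mul _).div_const 2
  have hquad : Integrable (fun ω => 1 - (θ * X ω) ^ 2 / 2) P := by
    simp only [mul_pow]
    exact (integrable_const 1).sub hsq
  have hpoly : Integrable (fun ω =>
      ((1 - (θ * X ω) ^ 2 / 2 : ℝ) : ℂ) + (θ * X ω : ℝ) * Complex.I) P :=
    hquad.ofReal.add (hlin.ofReal.mul_const _)
  rw [integral_sub hexp hpoly, integral_add hquad.ofReal (hlin.ofReal.mul_const _),
    integral_mul_const, integral_complex_ofReal, integral_complex_ofReal, integral_const_mul, hmean,
    charFun_apply_real, integral_map hmeas (by fun_prop), variance_of_integral_eq_zero hmeas hmean]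
  simp only [mul_pow, Complex.ofReal_mul]
  rw [integral_sub (integrable_const 1) hsq, integral_div, integral_const_mul, integral_const,
    probReal_univ, one_smul]
  simp [mul_comm]

theorem norm_charFun_map_sub_le_of_integral_eq_zero {X : Ω → ℝ} (hX : AEMeasurable X P)
    (hmean : P[X] = 0) (hK : ∀ᵐ ω ∂P, |X ω| ≤ K) (hθ : K * |θ| ≤ 1) :
    ‖charFun (P.map X) θ - (1 - Var[X; P] * θ ^ 2 / 2 : ℝ)‖ ≤ K * Var[X; P] * |θ| ^ 3 := by
  have hLp : MemLp X 2 P := .of_bound hX.aestronglyMeasurable K hK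
  rw [charFun_map_sub_eq_integral_of_integral_eq_zero hLp hmean,
    variance_of_integral_eq_zero hX hmean,
    show K * (∫ ω, X ω ^ 2 ∂P) * |θ| ^ 3 = ∫ ω, K * |θ| ^ 3 * X ω ^ 2 ∂P by
      rw [integral_const_mul]; ring]
  refine norm_integral_le_of_norm_le (hLp.integrable_sq.const_mul _) ?_
  filter_upwards [hK] with ω hω
  have habs : |θ * X ω| ≤ 1 := by
    rw [abs_mul, mul_comm]
    exact (mul_le_mul_of_nonneg_right hω (abs_nonneg θ)).trans hθ
  calc _ ≤ |θ * X ω| ^ 3 := by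
        refine (le_of_eq ?_).trans (norm_exp_mul_I_sub_le habs)
        push_cast
        congr 2
        ring
    _ = |X ω| * (|θ| ^ 3 * X ω ^ 2) := by rw [abs_mul, ← sq_abs (X ω)]; ring
    _ ≤ K * (|θ| ^ 3 * X ω ^ 2) := by gcongr
    _ = K * |θ| ^ 3 * X ω ^ 2 := by ring

theorem norm_charFun_map_sub_exp_le_of_integral_eq_zero {X : Ω → ℝ} (hX : AEMeasurable X P)
    (hmean : P[X] = 0) (hK : ∀ᵐ ω ∂P, |X ω| ≤ K) (hθ : K * |θ| ≤ 1) :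
    ‖charFun (P.map X) θ - (Real.exp (-(Var[X; P] * θ ^ 2 / 2)) : ℝ)‖ ≤
      2 * K * Var[X; P] * |θ| ^ 3 := by
  obtain ⟨ω, hω⟩ := hK.exists
  have hK0 : 0 ≤ K := (abs_nonneg _).trans hω
  have hv0 : 0 ≤ Var[X; P] := variance_nonneg X P
  have hvK : Var[X; P] ≤ K ^ 2 := by
    refine (variance_le_sq_of_bounded (hK.mono fun _ h => abs_le.1 h) hX).trans_eq (by ring)
  have hvθ : Var[X; P] * |θ| ≤ K := by
    nlinarith [mul_le_mul_of_nonneg_right hvK (abs_nonneg θ)]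
  have hu : Var[X; P] * θ ^ 2 / 2 ≤ 1 := by
    rw [← sq_abs θ]
    nlinarith [mul_le_mul_of_nonneg_right hvθ (abs_nonneg θ)]
  have hexp : ‖((1 - Var[X; P] * θ ^ 2 / 2 : ℝ) : ℂ) -
      (Real.exp (-(Var[X; P] * θ ^ 2 / 2)) : ℝ)‖ ≤ K * Var[X; P] * |θ| ^ 3 := by
    rw [← Complex.ofReal_sub, Complex.norm_real, norm_sub_rev]
    have hu' : ‖-(Var[X; P] * θ ^ 2 / 2)‖ = Var[X; P] * θ ^ 2 / 2 := by
      rw [norm_neg, Real.norm_of_nonneg (by positivity)]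
    have := Real.norm_exp_sub_one_sub_id_le (x := -(Var[X; P] * θ ^ 2 / 2)) (by rwa [hu'])
    rw [hu', sub_sub, ← sub_eq_add_neg] at this
    refine this.trans ?_
    calc (Var[X; P] * θ ^ 2 / 2) ^ 2 = Var[X; P] * |θ| * (Var[X; P] * |θ| ^ 3) / 4 := by
          rw [← sq_abs θ]; ring
      _ ≤ K * (Var[X; P] * |θ| ^ 3) / 4 := by gcongr
      _ ≤ K * Var[X; P] * |θ| ^ 3 := by
          have : 0 ≤ K * (Var[X; P] * |θ| ^ 3) := by positivity
          linarith
  have htaylor := norm_charFun_map_sub_le_of_integral_eq_zero hX hmean hK hθ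
  linarith [norm_sub_le_norm_sub_add_norm_sub (charFun (P.map X) θ)
    ((1 - Var[X; P] * θ ^ 2 / 2 : ℝ) : ℂ) (Real.exp (-(Var[X; P] * θ ^ 2 / 2)) : ℝ)]

theorem norm_charFun_map_sum_sub_exp_le_of_integral_eq_zero {ι : Type*} [Fintype ι]
    {X : ι → Ω → ℝ} (hX : ∀ i, AEMeasurable (X i) P) (hindep : iIndepFun X P)
    (hmean : ∀ i, P[X i] = 0) (hK : ∀ i, ∀ᵐ ω ∂P, |X i ω| ≤ K) (hθ : K * |θ| ≤ 1) :
    ‖charFun (P.map fun ω => ∑ i, X i ω) θ -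
        (Real.exp (-(Var[fun ω => ∑ i, X i ω; P] * θ ^ 2 / 2)) : ℝ)‖ ≤
      2 * K * Var[fun ω => ∑ i, X i ω; P] * |θ| ^ 3 := by
  have hvar : Var[fun ω => ∑ i, X i ω; P] = ∑ i, Var[X i; P] := by
    rw [← IndepFun.variance_sum
      (fun i _ => .of_bound (hX i).aestronglyMeasurable K (hK i))
      fun i _ j _ hij => hindep.indepFun hij]
    simp only [Finset.sum_fn]
  have hexp : ((Real.exp (-((∑ i, Var[X i; P]) * θ ^ 2 / 2)) : ℝ) : ℂ) =
      ∏ i, ((Real.exp (-(Var[X i; P] * θ ^ 2 / 2)) : ℝ) : ℂ) := by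
    rw [← Complex.ofReal_prod, ← Real.exp_sum, Finset.sum_neg_distrib, ← Finset.sum_div,
      ← Finset.sum_mul]
  rw [hvar, hexp, hindep.charFun_map_fun_sum_eq_prod hX, Finset.prod_apply]
  have : ∀ i, IsProbabilityMeasure (P.map (X i)) := fun i => Measure.isProbabilityMeasure_map (hX i)
  refine (norm_prod_sub_prod_le _ (fun i => norm_charFun_le_one θ) fun i => ?_).trans ?_
  · rw [Complex.norm_real, Real.norm_of_nonneg (Real.exp_pos _).le, Real.exp_le_one_iff, neg_nonpos]
    have := variance_nonneg (X i) P
    positivity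
  · rw [Finset.mul_sum, Finset.sum_mul]
    exact Finset.sum_le_sum fun i _ =>
      norm_charFun_map_sub_exp_le_of_integral_eq_zero (hX i) (hmean i) (hK i) hθ

theorem norm_charFun_map_sum_sub_integral_sub_exp_le {ι : Type*} [Fintype ι]
    {X : ι → Ω → ℝ} (hX : ∀ i, AEMeasurable (X i) P) (hindep : iIndepFun X P)
    (hK : ∀ i, ∀ᵐ ω ∂P, |X i ω| ≤ K) (hθ : 2 * K * |θ| ≤ 1) :
    ‖charFun (P.map fun ω => ∑ i, X i ω - ∫ ω', ∑ i, X i ω' ∂P) θ -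
        (Real.exp (-(Var[fun ω => ∑ i, X i ω; P] * θ ^ 2 / 2)) : ℝ)‖ ≤
      4 * K * Var[fun ω => ∑ i, X i ω; P] * |θ| ^ 3 := by
  have hint : ∀ i, Integrable (X i) P := fun i => .of_bound (hX i).aestronglyMeasurable K (hK i)
  have hmean_le : ∀ i, |P[X i]| ≤ K := fun i => by
    simpa using norm_integral_le_of_norm_le_const (μ := P) (f := X i) (hK i)
  have hcentre : (fun ω => ∑ i, X i ω - ∫ ω', ∑ i, X i ω' ∂P) =
      fun ω => ∑ i, (X i ω - P[X i]) := by
    funext ω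
    rw [integral_finsetSum _ fun i _ => hint i, Finset.sum_sub_distrib]
  have hvar : Var[fun ω => ∑ i, X i ω; P] = Var[fun ω => ∑ i, (X i ω - P[X i]); P] := by
    rw [← hcentre, variance_sub_const (by fun_prop)]
  rw [hcentre, hvar, show (4 : ℝ) * K = 2 * (2 * K) by ring]
  refine norm_charFun_map_sum_sub_exp_le_of_integral_eq_zero
    (fun i => (hX i).sub_const _)
    (hindep.comp (fun i x => x - ∫ ω, X i ω ∂P) fun i => measurable_id.sub_const _) (fun i => ?_)
    (fun i => ?_) hθ
  · rw [integral_sub (hint i) (integrable_const _), integral_const, probReal_univ, one_smul,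
      sub_self]
  · filter_upwards [hK i] with ω hω
    linarith [abs_sub (X i ω) (P[X i]), hmean_le i]

end CentralLimit

theorem tendstoInDistribution_sum_sub_integral_div_sqrt_variance
    {Ω : ℕ → Type*} {mΩ : ∀ n, MeasurableSpace (Ω n)} {P : ∀ n, Measure (Ω n)}
    [∀ n, IsProbabilityMeasure (P n)] {κ : ℕ → Type*} [∀ n, Fintype (κ n)]
    {X : ∀ n, κ n → Ω n → ℝ} {K : ℝ} (hX : ∀ n k, AEMeasurable (X n k) (P n))
    (hindep : ∀ n, iIndepFun (X n) (P n)) (hK : ∀ n k, ∀ᵐ ω ∂P n, |X n k ω| ≤ K)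
    (hvar : Tendsto (fun n => Var[fun ω => ∑ k, X n k ω; P n]) atTop atTop) :
    TendstoInDistribution
      (fun n ω => (∑ k, X n k ω - ∫ ω', ∑ k, X n k ω' ∂P n) / √(Var[fun ω => ∑ k, X n k ω; P n]))
      atTop (id : ℝ → ℝ) P (gaussianReal 0 1) where
  forall_aemeasurable n := by fun_prop
  tendsto := by
    refine ProbabilityMeasure.tendsto_iff_tendsto_charFun.2 fun t => ?_
    simp only [ProbabilityMeasure.coe_mk, Measure.map_id, charFun_gaussianReal]
    set V : ℕ → ℝ := fun n => Var[fun ω => ∑ k, X n k ω; P n]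
    have hsqrt : Tendsto (fun n => √(V n)) atTop atTop := Real.tendsto_sqrt_atTop.comp hvar
    have hlim : Tendsto (fun n => 4 * K * |t| ^ 3 / √(V n)) atTop (𝓝 0) := hsqrt.const_div_atTop _
    rw [tendsto_iff_norm_sub_tendsto_zero]
    refine squeeze_zero' (Eventually.of_forall fun _ => norm_nonneg _) ?_ hlim
    filter_upwards [hsqrt.eventually_ge_atTop (2 * K * |t|), hsqrt.eventually_gt_atTop 0]
      with n hn hpos
    have hsq : √(V n) ^ 2 = V n := Real.sq_sqrt (variance_nonneg _ _)
    have hVne : V n ≠ 0 := (Real.sqrt_pos.1 hpos).ne'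
    have habs : |(√(V n))⁻¹ * t| = |t| / √(V n) := by
      rw [abs_mul, abs_inv, abs_of_pos hpos, inv_mul_eq_div]
    have hbound := norm_charFun_map_sum_sub_integral_sub_exp_le (hX n) (hindep n) (hK n)
      (θ := (√(V n))⁻¹ * t) (by rwa [habs, ← mul_div_assoc, div_le_one hpos])
    rw [← charFun_map_mul_comp (by fun_prop)] at hbound
    have hgauss : V n * ((√(V n))⁻¹ * t) ^ 2 / 2 = t ^ 2 / 2 := by
      rw [mul_pow, inv_pow, hsq, ← mul_assoc, mul_inv_cancel₀ hVne, one_mul]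
    have hrate : 4 * K * V n * |(√(V n))⁻¹ * t| ^ 3 = 4 * K * |t| ^ 3 / √(V n) := by
      rw [habs, div_pow, pow_succ √(V n) 2, hsq]
      field_simp
    rw [hgauss, hrate] at hbound
    refine (le_of_eq ?_).trans hbound
    simp only [inv_mul_eq_div]
    congr 2
    push_cast
    simp

theorem tendstoInDistribution_of_forall_identDistrib {ι E Ω' : Type*} {Ω Ω₁ : ι → Type*}
    {mΩ : ∀ i, MeasurableSpace (Ω i)} {mΩ₁ : ∀ i, MeasurableSpace (Ω₁ i)}
    {mΩ' : MeasurableSpace Ω'} [TopologicalSpace E] [MeasurableSpace E] [OpensMeasurableSpace E]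
    {μ : ∀ i, Measure (Ω i)} [∀ i, IsProbabilityMeasure (μ i)]
    {ν : ∀ i, Measure (Ω₁ i)} [∀ i, IsProbabilityMeasure (ν i)]
    {μ' : Measure Ω'} [IsProbabilityMeasure μ'] {X : ∀ i, Ω i → E} {Y : ∀ i, Ω₁ i → E}
    {Z : Ω' → E} {l : Filter ι} (hY : TendstoInDistribution Y l Z ν μ')
    (hXY : ∀ i, IdentDistrib (X i) (Y i) (μ i) (ν i)) : TendstoInDistribution X l Z μ μ' where
  forall_aemeasurable i := (hXY i).aemeasurable_fst
  aemeasurable_limit := hY.aemeasurable_limit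
  tendsto := by simpa only [(hXY _).map_eq] using hY.tendsto

theorem abs_indicator_one_le {α : Type*} (s : Set α) (x : α) :
    |s.indicator (1 : α → ℝ) x| ≤ 1 := by
  by_cases hx : x ∈ s <;> simp [hx]

theorem variance_indicator_one {Ω : Type*} {mΩ : MeasurableSpace Ω} (μ : Measure Ω)
    [IsProbabilityMeasure μ] {s : Set Ω} (hs : MeasurableSet s) :
    Var[s.indicator 1; μ] = μ.real s * μ.real sᶜ := by
  have hsq : (s.indicator 1 : Ω → ℝ) ^ 2 = s.indicator 1 := by
    ext x
    by_cases hx : x ∈ s <;> simp [hx]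
  have hmem : MemLp (s.indicator 1 : Ω → ℝ) 2 μ :=
    memLp_indicator_const 2 hs 1 (Or.inr (measure_ne_top _ _))
  rw [variance_eq_sub hmem, hsq,
    integral_indicator_one hs, probReal_compl_eq_one_sub hs]
  ring

section Combinatorics

theorem prod_ite_finProdFinEquiv_lt {M : Type*} [CommMonoid M] {n : ℕ}
    (f : Fin n × Fin 2 → Fin n × Fin 2 → M) (k l : Fin n) :
    (∏ e, ∏ e', if finProdFinEquiv (k, e) < finProdFinEquiv (l, e') then
        f (k, e) (l, e') else 1) =
      (if k = l then f (k, 0) (k, 1) else 1) *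
        if k < l then ∏ e, ∏ e', f (k, e) (l, e') else 1 := by
  simp only [Fin.prod_univ_two, Fin.lt_def, finProdFinEquiv_apply_val, Fin.val_zero, Fin.val_one,
    Fin.ext_iff]
  rcases lt_trichotomy (k : ℕ) l with h | h | h
  · rw [if_pos (by omega), if_pos (by omega), if_pos (by omega), if_pos (by omega),
      if_neg (by omega), if_pos h, one_mul]
  · rw [if_neg (by omega), if_pos (by omega), if_neg (by omega), if_neg (by omega),
      if_pos h, if_neg (by omega), Fin.ext h, one_mul, one_mul, mul_one]
  · rw [if_neg (by omega), if_neg (by omega), if_neg (by omega), if_neg (by omega),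
      if_neg (by omega), if_neg (by omega), one_mul, one_mul]

theorem det_of_pow_finProdFinEquiv {R : Type*} [CommRing R] {n : ℕ} (v : Fin n × Fin 2 → R) :
    (Matrix.of fun i j : Fin n × Fin 2 => v i ^ (finProdFinEquiv j : ℕ)).det =
      (∏ k, (v (k, 1) - v (k, 0))) *
        ∏ l, ∏ k ∈ Finset.Iio l, ∏ e, ∏ e', (v (l, e') - v (k, e)) := by
  have hsub : (Matrix.of fun i j : Fin n × Fin 2 => v i ^ (finProdFinEquiv j : ℕ)) =
      (Matrix.vandermonde (v ∘ finProdFinEquiv.symm)).submatrix finProdFinEquiv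
        finProdFinEquiv := by
    ext i j
    simp [Matrix.vandermonde_apply]
  have hIoi : ∀ {m : ℕ} (i : Fin m) (f : Fin m → R),
      ∏ j ∈ Finset.Ioi i, f j = ∏ j, if i < j then f j else 1 := fun i f => by
    rw [← Finset.prod_filter, Finset.filter_lt_eq_Ioi]
  rw [hsub, Matrix.det_submatrix_equiv_self, Matrix.det_vandermonde]
  simp_rw [hIoi, ← (finProdFinEquiv (m := n) (n := 2)).prod_comp, Fintype.prod_prod_type]
  simp only [Function.comp_apply, Equiv.symm_apply_apply]
  rw [Finset.prod_congr rfl fun k _ => Finset.prod_comm]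
  simp_rw [prod_ite_finProdFinEquiv_lt fun i j => v j - v i]
  rw [Finset.prod_congr rfl fun k _ => Finset.prod_mul_distrib, Finset.prod_mul_distrib]
  simp_rw [Finset.prod_ite_eq, Finset.mem_univ, if_true, ← hIoi]
  congr 1
  exact Finset.prod_comm' (by simp)

theorem val_apply_eq_add_one_of_even {m : ℕ} {τ : Fin m → Fin m} (hτ : Function.Injective τ)
    (hadj : ∀ x, (τ x : ℕ) = x + 1 ∨ (x : ℕ) = τ x + 1) (x : Fin m) (hx : Even (x : ℕ)) :
    (τ x : ℕ) = x + 1 := by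
  induction x using WellFoundedLT.induction with
  | ind x ih =>
    refine (hadj x).resolve_right fun hlt => ?_
    obtain ⟨i, hi⟩ := hx
    have := x.isLt
    let y : Fin m := ⟨x - 2, by omega⟩
    have hy : (y : ℕ) = x - 2 := rfl
    have hτy := ih y (by rw [Fin.lt_def]; omega) ⟨i - 1, by omega⟩
    have hyx : y = x := hτ (Fin.ext (by omega))
    rw [Fin.ext_iff] at hyx
    omega

theorem fst_apply_eq_of_adjacent {n : ℕ} (σ : Equiv.Perm (Fin n × Fin 2))
    (hadj : ∀ k, (finProdFinEquiv (σ (k, 1)) : ℕ) = finProdFinEquiv (σ (k, 0)) + 1 ∨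
      (finProdFinEquiv (σ (k, 0)) : ℕ) = finProdFinEquiv (σ (k, 1)) + 1) (k : Fin n) :
    (σ (k, 0)).1 = (σ (k, 1)).1 := by
  let ρ := σ.trans finProdFinEquiv
  let τ : Equiv.Perm (Fin (n * 2)) :=
    (ρ.symm.trans ((Equiv.refl (Fin n)).prodCongr (Equiv.swap 0 1))).trans ρ
  have hτρ : ∀ k e, τ (ρ (k, e)) = ρ (k, Equiv.swap 0 1 e) := fun k e => by simp [τ]
  have hτ : ∀ x, (τ x : ℕ) = x + 1 ∨ (x : ℕ) = τ x + 1 := fun x => by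
    obtain ⟨⟨k, e⟩, rfl⟩ := ρ.surjective x
    rw [hτρ]
    fin_cases e
    · exact hadj k
    · exact (hadj k).symm
  have heven : ∀ e, Even (finProdFinEquiv (σ (k, e)) : ℕ) →
      (finProdFinEquiv (σ (k, Equiv.swap 0 1 e)) : ℕ) = finProdFinEquiv (σ (k, e)) + 1 :=
    fun e he => hτρ k e ▸ val_apply_eq_add_one_of_even τ.injective hτ (ρ (k, e)) he
  have h0 := heven 0
  have h1 := heven 1
  have hk := hadj k
  rw [Equiv.swap_apply_left] at h0
  rw [Equiv.swap_apply_right] at h1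
  simp only [finProdFinEquiv_apply_val, Nat.even_iff] at h0 h1 hk
  exact Fin.ext (by omega)

/-- The skew moment `∫ z ^ p * conj z ^ q * (z - conj z) * g ‖z‖` of a radial density with even
moments `m q = ∫ ‖z‖ ^ (2 * q) * g ‖z‖`. -/
def skewMoment (m : ℕ → ℂ) (p q : ℕ) : ℂ :=
  (if p + 1 = q then m q else 0) - if p = q + 1 then m p else 0

theorem exists_prod_skewMoment_eq {n : ℕ} (σ : Equiv.Perm (Fin n × Fin 2)) :
    ∃ C : ℂ, ∀ m : ℕ → ℂ,
      ∏ k, skewMoment m (finProdFinEquiv (σ (k, 0))) (finProdFinEquiv (σ (k, 1))) =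
        C * ∏ j : Fin n, m (2 * j + 1) := by
  by_cases hadj : ∀ k, (finProdFinEquiv (σ (k, 1)) : ℕ) = finProdFinEquiv (σ (k, 0)) + 1 ∨
      (finProdFinEquiv (σ (k, 0)) : ℕ) = finProdFinEquiv (σ (k, 1)) + 1
  · have hfst := fst_apply_eq_of_adjacent σ hadj
    have hbij : Function.Bijective fun k => (σ (k, 0)).1 := by
      rw [← Finite.surjective_iff_bijective]
      intro c
      obtain ⟨⟨k, e⟩, hke⟩ := σ.surjective (c, 0)
      refine ⟨k, ?_⟩
      fin_cases e
      · exact congrArg Prod.fst hke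
      · exact (hfst k).trans (congrArg Prod.fst hke)
    refine ⟨∏ k, if (σ (k, 0)).2 = 0 then 1 else -1, fun m => ?_⟩
    rw [← hbij.prod_comp (fun j => m (2 * j + 1)), ← Finset.prod_mul_distrib]
    refine Finset.prod_congr rfl fun k _ => ?_
    have hk := hadj k
    have : (σ (k, 0)).2 = 0 ↔ ((σ (k, 0)).2 : ℕ) = 0 := Fin.ext_iff
    simp only [finProdFinEquiv_apply_val, ← hfst k] at hk ⊢
    unfold skewMoment
    rcases hk with hk | hk
    · rw [if_pos hk.symm, if_neg (by omega), if_pos (by omega), sub_zero, one_mul]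
      congr 1
      omega
    · rw [if_neg (by omega), if_pos hk, if_neg (by omega), zero_sub, neg_one_mul]
      congr 2
      omega
  · push Not at hadj
    obtain ⟨k, hne, hne'⟩ := hadj
    refine ⟨0, fun m => ?_⟩
    rw [zero_mul]
    refine Finset.prod_eq_zero (Finset.mem_univ k) ?_
    rw [skewMoment, if_neg hne.symm, if_neg hne', sub_zero]

theorem sqrt_div_four_le_card_filter {B : ℝ} (hB : 16 ≤ B) {N : ℕ} (hBN : B ≤ 2 * N) :
    √B / 4 ≤ (Finset.univ.filter fun j : Fin N =>
      B - √B ≤ (2 * j + 1 : ℕ) ∧ (2 * j + 1 : ℕ) ≤ B).card := by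
  have hs : 4 ≤ √B := Real.le_sqrt_of_sq_le (by linarith)
  have hsq : √B * √B = B := Real.mul_self_sqrt (by linarith)
  have hx : 0 ≤ (B - √B - 1) / 2 := by nlinarith
  have hy : 0 ≤ (B - 1) / 2 := by linarith
  set m := ⌈(B - √B - 1) / 2⌉₊
  set M := ⌊(B - 1) / 2⌋₊
  have hsurj : Set.SurjOn (fun j : Fin N => (j : ℕ)) (Finset.univ.filter fun j : Fin N =>
      B - √B ≤ (2 * j + 1 : ℕ) ∧ (2 * j + 1 : ℕ) ≤ B) (Finset.Icc m M) := fun i hi => by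
    obtain ⟨hmi, hiM⟩ := Finset.mem_Icc.1 hi
    rw [Nat.ceil_le] at hmi
    rw [Nat.le_floor_iff hy] at hiM
    have hiN : i < N := by
      have : (i : ℝ) < N := by linarith
      exact_mod_cast this
    refine ⟨⟨i, hiN⟩, Finset.mem_filter.2 ⟨Finset.mem_univ _, ?_, ?_⟩, rfl⟩ <;> push_cast <;>
      linarith
  calc √B / 4 ≤ (M + 1 : ℕ) - m := by
        have := Nat.lt_floor_add_one ((B - 1) / 2)
        have := Nat.ceil_lt_add_one hx
        push_cast
        linarith
    _ ≤ ((M + 1 - m : ℕ) : ℝ) := by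
        rw [sub_le_iff_le_add]
        exact_mod_cast le_tsub_add
    _ ≤ _ := by
        rw [← Nat.card_Icc]
        exact_mod_cast Finset.card_le_card_of_surjOn _ hsurj

end Combinatorics

section DeterminantIntegral

theorem integral_det_mul_prod {𝕜 α ι ε : Type*} [RCLike 𝕜] [MeasurableSpace α] {μ : Measure α}
    [SigmaFinite μ] [Fintype ι] [Fintype ε] [DecidableEq ι] [DecidableEq ε]
    {φ : ε → ι × ε → α → 𝕜} {w : α → 𝕜}
    (hint : ∀ p : ε → ι × ε, Integrable (fun x => (∏ e, φ e (p e) x) * w x) μ) :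
    ∫ z : ι → α, (Matrix.of fun i j : ι × ε => φ i.2 j (z i.1)).det * ∏ k, w (z k)
        ∂Measure.pi (fun _ => μ) =
      ∑ σ : Equiv.Perm (ι × ε), ((Equiv.Perm.sign σ : ℤ) : 𝕜) *
        ∏ k, ∫ x, (∏ e, φ e (σ (k, e)) x) * w x ∂μ := by
  have hexpand : ∀ z : ι → α,
      (Matrix.of fun i j : ι × ε => φ i.2 j (z i.1)).det * ∏ k, w (z k) =
        ∑ σ : Equiv.Perm (ι × ε), ((Equiv.Perm.sign σ : ℤ) : 𝕜) *
          ∏ k, (∏ e, φ e (σ (k, e)) (z k)) * w (z k) := fun z => by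
    rw [← Matrix.det_transpose, Matrix.det_apply', Finset.sum_mul]
    simp only [Matrix.transpose_apply, Matrix.of_apply, Fintype.prod_prod_type, mul_assoc,
      Finset.prod_mul_distrib]
  simp_rw [hexpand]
  rw [integral_finsetSum _ fun σ _ =>
    (Integrable.fintype_prod fun k => hint fun e => σ (k, e)).const_mul _]
  simp_rw [integral_const_mul]
  congr 1 with σ
  rw [integral_fintype_prod_eq_prod (f := fun k x => (∏ e, φ e (σ (k, e)) x) * w x)]

end DeterminantIntegral

section RadialIntegral

variable {g : ℝ → ℂ}

/-- The even moment `∫ |z| ^ (2 n) g(|z|)` of the radial density `g ∘ |·|` on the complex plane. -/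
noncomputable def radialMoment (g : ℝ → ℂ) (n : ℕ) : ℂ :=
  ∫ z : ℂ, (‖z‖ : ℂ) ^ (2 * n) * g ‖z‖

theorem integrable_pow_mul_conj_pow_mul_radial
    (hg : ∀ n : ℕ, Integrable fun z : ℂ => (‖z‖ : ℂ) ^ n * g ‖z‖) (p q : ℕ) :
    Integrable fun z : ℂ => z ^ p * (starRingEnd ℂ) z ^ q * g ‖z‖ := by
  have hmeas : AEStronglyMeasurable fun z : ℂ => g ‖z‖ := by
    simpa using (hg 0).aestronglyMeasurable
  have hpow : Continuous fun z : ℂ => z ^ p * (starRingEnd ℂ) z ^ q := by fun_prop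
  refine (hg (p + q)).mono (hpow.aestronglyMeasurable.mul hmeas) (Eventually.of_forall fun z => ?_)
  simp [pow_add]

theorem integral_pow_mul_conj_pow_mul_radial (g : ℝ → ℂ) (p q : ℕ) :
    ∫ z : ℂ, z ^ p * (starRingEnd ℂ) z ^ q * g ‖z‖ = if p = q then radialMoment g q else 0 := by
  split_ifs with hpq
  · subst hpq
    simp only [radialMoment, ← mul_pow, Complex.mul_conj', pow_mul]
  · -- The rotation by `θ` multiplies the integrand by `exp (i θ (p - q)) = -1`.
    have hpq' : (p : ℂ) - q ≠ 0 := sub_ne_zero.2 (by exact_mod_cast hpq)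
    let θ : ℝ := Real.pi / (p - q)
    have hphase : (Circle.exp θ : ℂ) ^ p * (starRingEnd ℂ) (Circle.exp θ : ℂ) ^ q = -1 := by
      rw [Circle.coe_exp, ← Complex.exp_conj, ← Complex.exp_nat_mul, ← Complex.exp_nat_mul,
        ← Complex.exp_add, ← Complex.exp_pi_mul_I, map_mul, Complex.conj_ofReal, Complex.conj_I]
      congr 1
      push_cast [θ]
      field_simp
      ring
    have hrot := (rotation (Circle.exp θ)).measurePreserving.integral_comp
      (rotation (Circle.exp θ)).toHomeomorph.measurableEmbedding
      (fun z : ℂ => z ^ p * (starRingEnd ℂ) z ^ q * g ‖z‖)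
    have hneg : ∀ z : ℂ, (rotation (Circle.exp θ) z) ^ p *
        (starRingEnd ℂ) (rotation (Circle.exp θ) z) ^ q * g ‖rotation (Circle.exp θ) z‖ =
        -(z ^ p * (starRingEnd ℂ) z ^ q * g ‖z‖) := fun z => by
      rw [LinearIsometryEquiv.norm_map, rotation_apply, map_mul, mul_pow, mul_pow]
      linear_combination z ^ p * (starRingEnd ℂ) z ^ q * g ‖z‖ * hphase
    simp_rw [hneg, integral_neg] at hrot
    exact self_eq_neg.1 hrot.symm

theorem integral_pow_mul_conj_pow_mul_sub_conj_mul_radial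
    (hg : ∀ n : ℕ, Integrable fun z : ℂ => (‖z‖ : ℂ) ^ n * g ‖z‖) (p q : ℕ) :
    ∫ z : ℂ, z ^ p * (starRingEnd ℂ) z ^ q * ((z - (starRingEnd ℂ) z) * g ‖z‖) =
      skewMoment (radialMoment g) p q := by
  have hsplit : ∀ z : ℂ, z ^ p * (starRingEnd ℂ) z ^ q * ((z - (starRingEnd ℂ) z) * g ‖z‖) =
      z ^ (p + 1) * (starRingEnd ℂ) z ^ q * g ‖z‖ - z ^ p * (starRingEnd ℂ) z ^ (q + 1) * g ‖z‖ :=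
    fun z => by ring
  simp_rw [hsplit]
  rw [integral_sub (integrable_pow_mul_conj_pow_mul_radial hg _ _)
    (integrable_pow_mul_conj_pow_mul_radial hg _ _), integral_pow_mul_conj_pow_mul_radial,
    integral_pow_mul_conj_pow_mul_radial, skewMoment]
  congr 1
  split_ifs with hpq
  · rw [hpq]
  · rfl

theorem integrable_pow_mul_conj_pow_mul_sub_conj_mul_radial
    (hg : ∀ n : ℕ, Integrable fun z : ℂ => (‖z‖ : ℂ) ^ n * g ‖z‖) (p q : ℕ) :
    Integrable fun z : ℂ => z ^ p * (starRingEnd ℂ) z ^ q * ((z - (starRingEnd ℂ) z) * g ‖z‖) := by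
  refine ((integrable_pow_mul_conj_pow_mul_radial hg (p + 1) q).sub
    (integrable_pow_mul_conj_pow_mul_radial hg p (q + 1))).congr (Eventually.of_forall fun z => ?_)
  simp only [Pi.sub_apply]
  ring

theorem exists_integral_det_mul_prod_radial_eq (n : ℕ) :
    ∃ C : ℂ, ∀ g : ℝ → ℂ, (∀ m : ℕ, Integrable fun z : ℂ => (‖z‖ : ℂ) ^ m * g ‖z‖) →
      ∫ z : Fin n → ℂ, (Matrix.of fun i j : Fin n × Fin 2 =>
          ![z i.1, (starRingEnd ℂ) (z i.1)] i.2 ^ (finProdFinEquiv j : ℕ)).det *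
            ∏ k, (z k - (starRingEnd ℂ) (z k)) * g ‖z k‖ =
        C * ∏ j : Fin n, radialMoment g (2 * j + 1) := by
  choose C hC using exists_prod_skewMoment_eq (n := n)
  refine ⟨∑ σ, ((Equiv.Perm.sign σ : ℤ) : ℂ) * C σ, fun g hg => ?_⟩
  rw [volume_pi, integral_det_mul_prod
    (φ := fun e j x => ![x, (starRingEnd ℂ) x] e ^ (finProdFinEquiv j : ℕ))
    (w := fun x => (x - (starRingEnd ℂ) x) * g ‖x‖) fun p => by
      simpa only [Fin.prod_univ_two, Matrix.cons_val_zero, Matrix.cons_val_one] using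
        integrable_pow_mul_conj_pow_mul_sub_conj_mul_radial hg _ _, Finset.sum_mul]
  simp only [Fin.prod_univ_two, Matrix.cons_val_zero, Matrix.cons_val_one,
    integral_pow_mul_conj_pow_mul_sub_conj_mul_radial hg, hC]
  simp only [mul_assoc]

end RadialIntegral

section GammaMeasure

theorem gammaPDFReal_natCast_add_one (n : ℕ) (c : ℝ) {x : ℝ} (hx : 0 ≤ x) :
    gammaPDFReal (n + 1) c x = c ^ (n + 1) / n.factorial * x ^ n * Real.exp (-(c * x)) := by
  rw [gammaPDFReal, if_pos hx, Real.Gamma_nat_eq_factorial, add_sub_cancel_right,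
    Real.rpow_natCast]
  norm_cast

theorem integral_gammaMeasure {E : Type*} [NormedAddCommGroup E] [NormedSpace ℝ E] {a c : ℝ}
    (ha : 0 < a) (hc : 0 < c) (f : ℝ → E) :
    ∫ x, f x ∂gammaMeasure a c = ∫ x in Set.Ioi 0, gammaPDFReal a c x • f x := by
  rw [gammaMeasure, integral_withDensity_eq_integral_toReal_smul
    (f := gammaPDF a c) (measurable_gammaPDFReal a c).ennreal_ofReal
    (Eventually.of_forall fun _ => ENNReal.ofReal_lt_top), ← integral_Ici_eq_integral_Ioi]
  simp only [gammaPDF, ENNReal.toReal_ofReal (gammaPDFReal_nonneg ha hc _)]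
  refine (setIntegral_eq_integral_of_forall_compl_eq_zero fun x hx => ?_).symm
  rw [gammaPDFReal, if_neg (Set.mem_Ici.not.1 hx), zero_smul]

theorem radialMoment_eq_integral_Ioi (g : ℝ → ℂ) (n : ℕ) :
    radialMoment g n = Real.pi * ∫ x in Set.Ioi (0 : ℝ), (x : ℂ) ^ n * g (√x) := by
  have hpolar := integral_fun_norm_addHaar (volume : Measure ℂ) fun r : ℝ =>
    (r : ℂ) ^ (2 * n) * g r
  rw [Complex.finrank_real_complex, Measure.real, Complex.volume_ball] at hpolar
  rw [radialMoment, hpolar,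
    ← integral_comp_rpow_Ioi_of_pos (g := fun x : ℝ => (x : ℂ) ^ n * g √x) two_pos]
  have hsq : ∀ y ∈ Set.Ioi (0 : ℝ), (2 * y ^ ((2 : ℝ) - 1)) •
      (((y ^ (2 : ℝ) : ℝ) : ℂ) ^ n * g √(y ^ (2 : ℝ))) =
      (2 : ℝ) • y ^ (2 - 1) • ((y : ℂ) ^ (2 * n) * g y) := fun y hy => by
    rw [Real.rpow_two, Real.sqrt_sq (le_of_lt hy), Complex.ofReal_pow, pow_mul,
      show (2 : ℝ) - 1 = (1 : ℕ) by norm_num, Real.rpow_natCast, mul_smul]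
  rw [setIntegral_congr_fun measurableSet_Ioi hsq]
  rw [integral_smul, ENNReal.ofReal_one, one_pow, one_mul, ENNReal.coe_toReal, NNReal.coe_real_pi,
    smul_comm, Complex.real_smul, ofNat_smul_eq_nsmul ℝ 2]

theorem radialMoment_mul_exp_eq_integral_gammaMeasure {c : ℝ} (hc : 0 < c) (h : ℝ → ℂ) (n : ℕ) :
    radialMoment (fun r => h r * Real.exp (-c * r ^ 2)) n =
      (Real.pi * n.factorial / c ^ (n + 1) : ℝ) * ∫ x, h √x ∂gammaMeasure (n + 1) c := by
  have hn : (n.factorial : ℂ) ≠ 0 := by exact_mod_cast n.factorial_ne_zero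
  have hc' : (c : ℂ) ≠ 0 := by exact_mod_cast hc.ne'
  rw [radialMoment_eq_integral_Ioi, integral_gammaMeasure (by positivity) hc,
    ← integral_const_mul, ← integral_const_mul]
  refine setIntegral_congr_fun measurableSet_Ioi fun x hx => ?_
  simp only [gammaPDFReal_natCast_add_one n c (le_of_lt hx), Real.sq_sqrt (le_of_lt hx),
    Complex.real_smul]
  push_cast
  rw [neg_mul]
  field_simp

theorem factorial_le_exp_one_mul_sqrt_mul_pow {n : ℕ} (hn : 1 ≤ n) :
    (n.factorial : ℝ) ≤ Real.exp 1 * √n * (n / Real.exp 1) ^ n := by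
  obtain ⟨m, rfl⟩ := Nat.exists_eq_add_of_le' hn
  have h := Stirling.stirlingSeq'_antitone (Nat.zero_le m)
  simp only [Function.comp_apply, Nat.succ_eq_add_one, zero_add, Stirling.stirlingSeq_one] at h
  rw [Stirling.stirlingSeq, div_le_iff₀ (by positivity)] at h
  refine h.trans_eq ?_
  rw [Real.sqrt_mul zero_le_two]
  field_simp

theorem exp_neg_sq_div_mul_pow_le {n t : ℝ} (hn : 0 < n) (ht : 0 < t) :
    Real.exp (-((t - n) ^ 2 / t)) * n ^ n ≤ t ^ n * Real.exp (n - t) := by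
  have hlog : -((t - n) ^ 2 / t) ≤ n * Real.log (t / n) + (n - t) :=
    calc -((t - n) ^ 2 / t) = n * (1 - (t / n)⁻¹) + (n - t) := by field_simp; ring
      _ ≤ n * Real.log (t / n) + (n - t) := by
        gcongr; exact Real.one_sub_inv_le_log_of_pos (div_pos ht hn)
  calc Real.exp (-((t - n) ^ 2 / t)) * n ^ n
      ≤ Real.exp (n * Real.log (t / n) + (n - t)) * n ^ n := by gcongr
    _ = (t / n) ^ n * n ^ n * Real.exp (n - t) := by
        rw [Real.exp_add, mul_comm n, ← Real.rpow_def_of_pos (div_pos ht hn)]; ring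
    _ = t ^ n * Real.exp (n - t) := by
        rw [← Real.mul_rpow (by positivity) hn.le, div_mul_cancel₀ _ hn.ne']

theorem le_gammaPDFReal_natCast_add_one {n : ℕ} (hn : 1 ≤ n) {c x : ℝ} (hc : 0 < c) (hx : 0 < x) :
    c * (Real.exp (-1 - (c * x - n) ^ 2 / (c * x)) / √n) ≤ gammaPDFReal (n + 1) c x := by
  have hn' : (0 : ℝ) < n := by exact_mod_cast hn
  have hpow := exp_neg_sq_div_mul_pow_le hn' (mul_pos hc hx)
  simp only [Real.rpow_natCast] at hpow
  have hexp : Real.exp (n : ℝ) = Real.exp 1 ^ n := by rw [← Real.exp_nat_mul, mul_one]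
  rw [gammaPDFReal_natCast_add_one n c hx.le, mul_div_assoc', div_mul_eq_mul_div,
    div_mul_eq_mul_div, div_le_div_iff₀ (by positivity) (by positivity)]
  calc c * Real.exp (-1 - (c * x - n) ^ 2 / (c * x)) * n.factorial
      ≤ c * Real.exp (-1 - (c * x - n) ^ 2 / (c * x)) *
          (Real.exp 1 * √n * (n / Real.exp 1) ^ n) := by
        gcongr
        exact factorial_le_exp_one_mul_sqrt_mul_pow hn
    _ = c * √n * (Real.exp (-((c * x - n) ^ 2 / (c * x))) * n ^ n) / Real.exp n := by
        rw [sub_eq_add_neg, Real.exp_add, Real.exp_neg 1, div_pow, hexp]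
        field_simp
    _ ≤ c * √n * ((c * x) ^ n * Real.exp (n - c * x)) / Real.exp n := by gcongr
    _ = c ^ (n + 1) * x ^ n * Real.exp (-(c * x)) * √n := by
        rw [sub_eq_add_neg, Real.exp_add, mul_pow, pow_succ']
        field_simp

theorem le_gammaPDFReal_of_near {B c x : ℝ} (hB : 16 ≤ B) (hc : 0 < c) {n : ℕ}
    (hn : B - √B ≤ n) (hn' : n ≤ B) (hx : B - √B ≤ c * x) (hx' : c * x ≤ B + √B) :
    c * (Real.exp (-9) / √B) ≤ gammaPDFReal (n + 1) c x := by
  have hs : 4 ≤ √B := Real.le_sqrt_of_sq_le (by linarith)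
  have hsq : √B * √B = B := Real.mul_self_sqrt (by linarith)
  have hB2 : B / 2 ≤ B - √B := by nlinarith
  have hn0 : (0 : ℝ) < n := by linarith
  have hcx : 0 < c * x := by linarith
  have hdev : (c * x - n) ^ 2 / (c * x) ≤ 8 := by
    rw [div_le_iff₀ hcx]
    calc (c * x - n) ^ 2 ≤ (2 * √B) ^ 2 := sq_le_sq' (by linarith) (by linarith)
      _ ≤ 8 * (c * x) := by linarith
  refine le_trans ?_ (le_gammaPDFReal_natCast_add_one (Nat.cast_pos.1 hn0) hc
    (pos_of_mul_pos_right hcx hc.le))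
  gcongr
  linarith

theorem mul_le_gammaMeasure_real_Ioc {a c d u v : ℝ} (ha : 0 < a) (hc : 0 < c) (huv : u ≤ v)
    (hd : ∀ x ∈ Set.Ioc u v, d ≤ gammaPDFReal a c x) :
    d * (v - u) ≤ (gammaMeasure a c).real (Set.Ioc u v) := by
  have := isProbabilityMeasure_gammaMeasure ha hc
  have hle : ENNReal.ofReal d * volume (Set.Ioc u v) ≤ gammaMeasure a c (Set.Ioc u v) := by
    rw [gammaMeasure, withDensity_apply _ measurableSet_Ioc, ← setLIntegral_const]
    exact setLIntegral_mono (measurable_gammaPDFReal a c).ennreal_ofReal fun x hx =>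
      ENNReal.ofReal_le_ofReal (hd x hx)
  rw [Real.volume_Ioc, ← ENNReal.ofReal_mul' (sub_nonneg.2 huv)] at hle
  exact (ENNReal.ofReal_le_iff_le_toReal (measure_ne_top _ _)).1 hle

theorem le_gammaMeasure_real_Ioc_of_near {B c u v : ℝ} (hB : 16 ≤ B) (hc : 0 < c) {n : ℕ}
    (hn : B - √B ≤ n) (hn' : n ≤ B) (hu : B - √B ≤ c * u) (huv : u ≤ v)
    (hv : c * v ≤ B + √B) :
    Real.exp (-9) * ((c * v - c * u) / √B) ≤ (gammaMeasure (n + 1) c).real (Set.Ioc u v) :=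
  calc Real.exp (-9) * ((c * v - c * u) / √B) = c * (Real.exp (-9) / √B) * (v - u) := by ring
    _ ≤ _ := mul_le_gammaMeasure_real_Ioc (by positivity) hc huv fun x hx =>
      le_gammaPDFReal_of_near hB hc hn hn' (hu.trans (by gcongr; exact hx.1.le))
        (le_trans (by gcongr; exact hx.2) hv)

/- Both factors are estimated within the window `|c x - c v| ≤ √(c v)`, where the density is of
order `1 / √(c v)` in the variable `c x`. -/
theorem le_gammaMeasure_real_Ioc_mul_real_Ioi {c u v : ℝ} (hc : 0 < c) (huv : u ≤ v)
    (hv : 16 ≤ c * v) {n : ℕ} (hn : c * v - √(c * v) ≤ n) (hn' : n ≤ c * v) :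
    Real.exp (-9) ^ 2 * (min (c * v - c * u) √(c * v) / √(c * v)) ≤
      (gammaMeasure (n + 1) c).real (Set.Ioc u v) * (gammaMeasure (n + 1) c).real (Set.Ioi v) := by
  have := isProbabilityMeasure_gammaMeasure (a := n + 1) (by positivity) hc
  set B := c * v
  have hs : 0 < √B := Real.sqrt_pos.2 (by linarith)
  have hinner : Real.exp (-9) * (min (B - c * u) √B / √B) ≤
      (gammaMeasure (n + 1) c).real (Set.Ioc u v) := by
    have hmul : c * max u (v - √B / c) = max (c * u) (B - √B) := by
      rw [mul_max_of_nonneg _ _ hc.le, mul_sub, mul_div_cancel₀ _ hc.ne']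
    have hle := le_gammaMeasure_real_Ioc_of_near hv hc hn hn'
      (u := max u (v - √B / c)) (v := v) (by rw [hmul]; exact le_max_right _ _)
      (max_le huv (sub_le_self _ (by positivity))) (le_add_of_nonneg_right hs.le)
    rw [hmul, ← min_sub_sub_left, sub_sub_cancel] at hle
    exact hle.trans (measureReal_mono (Set.Ioc_subset_Ioc_left (le_max_left _ _)))
  have houter : Real.exp (-9) ≤ (gammaMeasure (n + 1) c).real (Set.Ioi v) := by
    have hmul : c * (v + √B / c) = B + √B := by rw [mul_add, mul_div_cancel₀ _ hc.ne']
    have hle := le_gammaMeasure_real_Ioc_of_near hv hc hn hn' (u := v)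
      (sub_le_self _ hs.le) (le_add_of_nonneg_right (by positivity)) hmul.le
    rw [hmul, add_sub_cancel_left, div_self hs.ne', mul_one] at hle
    exact hle.trans (measureReal_mono Set.Ioc_subset_Ioi_self)
  calc Real.exp (-9) ^ 2 * (min (B - c * u) √B / √B)
      = Real.exp (-9) * (min (B - c * u) √B / √B) * Real.exp (-9) := by ring
    _ ≤ _ := mul_le_mul hinner houter (Real.exp_pos _).le measureReal_nonneg

end GammaMeasure

theorem tendsto_mul_sq_sub_sq_atTop {a b : ℕ → ℝ} {ε : ℝ} (hε : 0 < ε)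
    (ha : ∀ᶠ N in atTop, 0 ≤ a N) (hb : ∀ᶠ N in atTop, ε ≤ b N)
    (hab : Tendsto (fun N : ℕ => (N : ℝ) * (b N - a N)) atTop atTop) :
    Tendsto (fun N : ℕ => (N : ℝ) * (b N ^ 2 - a N ^ 2)) atTop atTop := by
  simp only [sq_sub_sq, mul_comm (_ + _), ← mul_assoc]
  refine tendsto_atTop_mono' _ ?_ (hab.atTop_mul_const hε)
  filter_upwards [ha, hb, hab.eventually_ge_atTop 0] with N ha hb hab
  gcongr
  linarith

namespace QuaternionGinibre

theorem weight_eq_det (N : ℕ) (z : Fin N → ℂ) :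
    (weight N z : ℂ) =
      (Matrix.of fun i j : Fin N × Fin 2 =>
        ![z i.1, (starRingEnd ℂ) (z i.1)] i.2 ^ (finProdFinEquiv j : ℕ)).det *
        ∏ k, (z k - (starRingEnd ℂ) (z k)) * (Real.exp (-(2 * N) * ‖z k‖ ^ 2) : ℂ) := by
  have hsq : ∀ x : ℂ, (‖x‖ : ℂ) ^ 2 = x * (starRingEnd ℂ) x := fun x => (Complex.mul_conj' x).symm
  rw [det_of_pow_finProdFinEquiv fun i : Fin N × Fin 2 => ![z i.1, (starRingEnd ℂ) (z i.1)] i.2,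
    mul_right_comm, ← Finset.prod_mul_distrib, weight]
  push_cast
  rw [mul_assoc, mul_comm, ← Finset.prod_mul_distrib]
  congr 1
  · refine Finset.prod_congr rfl fun k _ => ?_
    simp only [hsq, map_sub, Complex.conj_conj, neg_mul]
    ring
  · refine Finset.prod_congr rfl fun k _ => Finset.prod_congr rfl fun l _ => ?_
    simp only [hsq, map_sub, Complex.conj_conj, Fin.prod_univ_two, Matrix.cons_val_zero,
      Matrix.cons_val_one]
    ring

theorem integrable_pow_norm_mul_exp {h : ℝ → ℂ} {K c : ℝ} (hh : Measurable h)
    (hK : ∀ r, ‖h r‖ ≤ K) (hc : 0 < c) (n : ℕ) :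
    Integrable fun z : ℂ => (‖z‖ : ℂ) ^ n * (h ‖z‖ * Real.exp (-c * ‖z‖ ^ 2)) := by
  refine ((integrable_factor n hc).const_mul K).mono' (by fun_prop)
    (Eventually.of_forall fun z => ?_)
  calc ‖(‖z‖ : ℂ) ^ n * (h ‖z‖ * Real.exp (-c * ‖z‖ ^ 2))‖
      = ‖h ‖z‖‖ * (‖z‖ ^ n * Real.exp (-c * ‖z‖ ^ 2)) := by
        rw [norm_mul, norm_mul, norm_pow, Complex.norm_real, Complex.norm_real, norm_norm,
          Real.norm_of_nonneg (Real.exp_pos _).le]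
        ring
    _ ≤ K * ((1 + ‖z‖) ^ n * Real.exp (-c * ‖z‖ ^ 2)) := by
        gcongr
        · exact (norm_nonneg _).trans (hK 0)
        · exact hK _
        · linarith

theorem exists_integral_weight_mul_prod_eq {N : ℕ} (hN : 0 < N) :
    ∃ C : ℂ, ∀ h : ℝ → ℂ, Measurable h → (∃ K, ∀ r, ‖h r‖ ≤ K) →
      ∫ z : Fin N → ℂ, (weight N z : ℂ) * ∏ k, h ‖z k‖ =
        C * ∏ j : Fin N, ∫ x, h √x ∂gammaMeasure ((2 * j + 1 : ℕ) + 1) (2 * N) := by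
  have hc : (0 : ℝ) < 2 * N := by positivity
  obtain ⟨C, hC⟩ := exists_integral_det_mul_prod_radial_eq N
  refine ⟨C * ∏ j : Fin N,
    (Real.pi * (2 * j + 1 : ℕ).factorial / (2 * N) ^ (2 * (j : ℕ) + 1 + 1) : ℝ),
    fun h hh ⟨K, hK⟩ => ?_⟩
  have hmoment := hC (fun r => h r * Real.exp (-(2 * N) * r ^ 2))
    (integrable_pow_norm_mul_exp hh hK hc)
  simp only [radialMoment_mul_exp_eq_integral_gammaMeasure hc, Finset.prod_mul_distrib] at hmoment
  rw [Complex.ofReal_prod, mul_assoc, ← hmoment]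
  refine integral_congr_ae (Eventually.of_forall fun z => ?_)
  simp only [weight_eq_det, mul_assoc, Finset.prod_mul_distrib, mul_comm]

/-- The law of the `j`-th modulus in Kostlan's decomposition, the square root of a Gamma variable
of shape `2 j + 2` (the indices are `0`-based) and rate `2 N`. Under `law N` the moduli are
distributed, up to order, like independent variables with these laws. -/
noncomputable def modulusLaw (N : ℕ) (j : Fin N) : Measure ℝ :=
  (gammaMeasure ((2 * j + 1 : ℕ) + 1) (2 * N)).map Real.sqrt

instance isProbabilityMeasure_modulusLaw (N : ℕ) (j : Fin N) :
    IsProbabilityMeasure (modulusLaw N j) :=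
  have : 0 < (2 * N : ℝ) := by have := j.pos; positivity
  have := isProbabilityMeasure_gammaMeasure (a := (2 * j + 1 : ℕ) + 1) (by positivity) this
  Measure.isProbabilityMeasure_map Real.continuous_sqrt.measurable.aemeasurable

theorem integral_law {N : ℕ} (f : (Fin N → ℂ) → ℂ) :
    ∫ z, f z ∂law N = (partitionFunction N)⁻¹.toReal * ∫ z, (weight N z : ℂ) * f z := by
  rw [law, integral_smul_measure, integral_withDensity_eq_integral_toReal_smul
    (continuous_weight N).measurable.ennreal_ofReal
    (Eventually.of_forall fun _ => ENNReal.ofReal_lt_top)]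
  simp only [ENNReal.toReal_ofReal (weight_nonneg N _), Complex.real_smul]

theorem integral_prod_norm_law (N : ℕ) {h : ℝ → ℂ} (hh : Measurable h)
    (hK : ∃ K, ∀ r, ‖h r‖ ≤ K) :
    ∫ z, ∏ k, h ‖z k‖ ∂law N = ∏ j, ∫ r, h r ∂modulusLaw N j := by
  rcases N.eq_zero_or_pos with rfl | hN
  · simp
  obtain ⟨C, hC⟩ := exists_integral_weight_mul_prod_eq hN
  have hprod : ∀ g : ℝ → ℂ, Measurable g → (∃ K, ∀ r, ‖g r‖ ≤ K) →
      ∫ z, ∏ k, g ‖z k‖ ∂law N =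
        (partitionFunction N)⁻¹.toReal * C * ∏ j, ∫ r, g r ∂modulusLaw N j := fun g hg hgK => by
    simp only [integral_law, hC g hg hgK, mul_assoc, modulusLaw,
      integral_map Real.continuous_sqrt.measurable.aemeasurable hg.aestronglyMeasurable]
  have hone : 1 = (partitionFunction N)⁻¹.toReal * C := by
    simpa using hprod 1 measurable_one ⟨1, by simp⟩
  rw [hprod h hh hK, ← hone, one_mul]

theorem measurable_linearStatistic {N : ℕ} {f : ℂ → ℝ} (hf : Measurable f) :
    Measurable (linearStatistic (N := N) f) :=
  Finset.measurable_sum _ fun k _ => hf.comp (measurable_pi_apply k)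

theorem identDistrib_linearStatistic_norm (N : ℕ) {f : ℝ → ℝ} (hf : Measurable f) :
    IdentDistrib (linearStatistic fun w => f ‖w‖) (fun r : Fin N → ℝ => ∑ j, f (r j)) (law N)
      (Measure.pi (modulusLaw N)) where
  aemeasurable_fst := (measurable_linearStatistic (by fun_prop)).aemeasurable
  aemeasurable_snd := Measurable.aemeasurable (by fun_prop)
  map_eq := by
    refine Measure.ext_of_charFun (funext fun t => ?_)
    let h : ℝ → ℂ := fun r => Complex.exp (t * f r * Complex.I)
    have hexp : ∀ x : Fin N → ℝ, Complex.exp (t * (∑ k, f (x k) : ℝ) * Complex.I) =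
        ∏ k, h (x k) := fun x => by
      rw [← Complex.exp_sum, Complex.ofReal_sum, Finset.mul_sum, Finset.sum_mul]
    rw [charFun_apply_real, charFun_apply_real, integral_map
        (measurable_linearStatistic (by fun_prop)).aemeasurable (by fun_prop),
      integral_map (Measurable.aemeasurable (by fun_prop)) (by fun_prop)]
    simp only [linearStatistic, hexp]
    rw [integral_fintype_prod_eq_prod, ← integral_prod_norm_law N (by fun_prop)
      ⟨1, fun r => by
        simp only [h, ← Complex.ofReal_mul, Complex.norm_exp_ofReal_mul_I, le_refl]⟩]

theorem tendstoInDistribution_linearStatistic_norm {f : ℕ → ℝ → ℝ} {K : ℝ}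
    (hf : ∀ N, Measurable (f N)) (hK : ∀ N r, |f N r| ≤ K)
    (hvar : Tendsto (fun N => Var[linearStatistic fun w => f N ‖w‖; law N]) atTop atTop) :
    TendstoInDistribution
      (fun N z => (linearStatistic (fun w => f N ‖w‖) z -
        ∫ y, linearStatistic (fun w => f N ‖w‖) y ∂law N) /
          √(Var[linearStatistic fun w => f N ‖w‖; law N]))
      atTop (id : ℝ → ℝ) law (gaussianReal 0 1) := by
  have hident := fun N => identDistrib_linearStatistic_norm N (hf N)
  simp only [(hident _).variance_eq, (hident _).integral_eq] at hvar ⊢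
  refine tendstoInDistribution_of_forall_identDistrib
    (tendstoInDistribution_sum_sub_integral_div_sqrt_variance
      (P := fun N => Measure.pi (modulusLaw N)) (X := fun N j r => f N (r j)) (K := K)
      (fun N j => Measurable.aemeasurable (by fun_prop))
      (fun N => iIndepFun_pi fun j => (hf N).aemeasurable)
      (fun N j => Eventually.of_forall fun r => hK N (r j)) hvar) fun N => ?_
  exact (hident N).comp ((measurable_id.sub_const _).div_const _)

theorem variance_linearStatistic_norm (N : ℕ) {f : ℝ → ℝ} {K : ℝ} (hf : Measurable f)
    (hK : ∀ r, |f r| ≤ K) :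
    Var[linearStatistic fun w => f ‖w‖; law N] = ∑ j, Var[f; modulusLaw N j] := by
  rw [(identDistrib_linearStatistic_norm N hf).variance_eq]
  have := variance_sum_pi (μ := modulusLaw N) (X := fun _ => f) fun j =>
    MemLp.of_bound hf.aestronglyMeasurable K (Eventually.of_forall hK)
  rwa [Finset.sum_fn] at this

theorem le_variance_indicator_Icc_modulusLaw {a b : ℝ} (ha : 0 ≤ a) (hab : a ≤ b) {N : ℕ}
    {j : Fin N} (hb : 16 ≤ 2 * N * b ^ 2) (hj : 2 * N * b ^ 2 - √(2 * N * b ^ 2) ≤ (2 * j + 1 : ℕ))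
    (hj' : (2 * j + 1 : ℕ) ≤ 2 * N * b ^ 2) :
    Real.exp (-9) ^ 2 *
        (min (2 * N * b ^ 2 - 2 * N * a ^ 2) √(2 * N * b ^ 2) / √(2 * N * b ^ 2)) ≤
      Var[(Set.Icc a b).indicator 1; modulusLaw N j] := by
  have hN : 0 < (2 * N : ℝ) := by have := j.pos; positivity
  have := isProbabilityMeasure_gammaMeasure (a := (2 * j + 1 : ℕ) + 1) (by positivity) hN
  have hinner : Set.Ioc (a ^ 2) (b ^ 2) ⊆ Real.sqrt ⁻¹' Set.Icc a b := fun x hx =>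
    ⟨Real.le_sqrt_of_sq_le hx.1.le, Real.sqrt_le_iff.2 ⟨ha.trans hab, hx.2⟩⟩
  have houter : Set.Ioi (b ^ 2) ⊆ Real.sqrt ⁻¹' (Set.Icc a b)ᶜ := fun x hx hmem =>
    (Real.lt_sqrt_of_sq_lt hx).not_ge hmem.2
  rw [variance_indicator_one _ measurableSet_Icc, modulusLaw,
    map_measureReal_apply (by fun_prop) measurableSet_Icc,
    map_measureReal_apply (by fun_prop) measurableSet_Icc.compl]
  exact (le_gammaMeasure_real_Ioc_mul_real_Ioi hN (by gcongr) hb hj hj').trans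
    (mul_le_mul (measureReal_mono hinner) (measureReal_mono houter) measureReal_nonneg
      measureReal_nonneg)

theorem le_variance_radialCount {a b : ℝ} (ha : 0 ≤ a) (hab : a ≤ b) (hb : b ≤ 1) {N : ℕ}
    (hN : 16 ≤ 2 * N * b ^ 2) :
    Real.exp (-9) ^ 2 / 4 * min (2 * N * b ^ 2 - 2 * N * a ^ 2) √(2 * N * b ^ 2) ≤
      Var[radialCount a b; law N] := by
  set B := 2 * N * b ^ 2
  have hBN : B ≤ 2 * N :=
    mul_le_of_le_one_right (by positivity) (pow_le_one₀ (ha.trans hab) hb)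
  have hBpos : 0 < √B := Real.sqrt_pos.2 (by linarith)
  have hmin : 0 ≤ min (B - 2 * N * a ^ 2) √B :=
    le_min (sub_nonneg.2 (by unfold B; gcongr)) hBpos.le
  set W := Finset.univ.filter fun j : Fin N =>
    B - √B ≤ (2 * j + 1 : ℕ) ∧ (2 * j + 1 : ℕ) ≤ B
  calc Real.exp (-9) ^ 2 / 4 * min (B - 2 * N * a ^ 2) √B
      = √B / 4 * (Real.exp (-9) ^ 2 * (min (B - 2 * N * a ^ 2) √B / √B)) := by field_simp
    _ ≤ W.card * (Real.exp (-9) ^ 2 * (min (B - 2 * N * a ^ 2) √B / √B)) := by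
        gcongr
        exact sqrt_div_four_le_card_filter hN hBN
    _ ≤ ∑ j ∈ W, Var[(Set.Icc a b).indicator 1; modulusLaw N j] := by
        rw [← nsmul_eq_mul]
        refine Finset.card_nsmul_le_sum _ _ _ fun j hj => ?_
        obtain ⟨hj, hj'⟩ := (Finset.mem_filter.1 hj).2
        exact le_variance_indicator_Icc_modulusLaw ha hab hN hj hj'
    _ ≤ ∑ j, Var[(Set.Icc a b).indicator 1; modulusLaw N j] :=
        Finset.sum_le_univ_sum_of_nonneg fun j => variance_nonneg _ _
    _ = Var[radialCount a b; law N] := (variance_linearStatistic_norm N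
        (measurable_one.indicator measurableSet_Icc) (abs_indicator_one_le _)).symm

theorem tendsto_variance_radialCount {a b : ℕ → ℝ} (ha : ∀ᶠ N in atTop, 0 ≤ a N)
    (hb : ∀ᶠ N in atTop, b N ∈ Set.Icc 0 1)
    (hab : Tendsto (fun N : ℕ => (N : ℝ) * (b N ^ 2 - a N ^ 2)) atTop atTop) :
    Tendsto (fun N => Var[radialCount (a N) (b N); law N]) atTop atTop := by
  have hdiff : Tendsto (fun N : ℕ => 2 * N * b N ^ 2 - 2 * N * a N ^ 2) atTop atTop := by
    simpa only [mul_assoc, mul_sub] using hab.const_mul_atTop two_pos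
  have hB : Tendsto (fun N : ℕ => 2 * N * b N ^ 2) atTop atTop :=
    tendsto_atTop_mono (fun N => sub_le_self _ (by positivity)) hdiff
  refine tendsto_atTop_mono' _ ?_ ((tendsto_inf_atTop _ hdiff
    (Real.tendsto_sqrt_atTop.comp hB)).const_mul_atTop
      (show 0 < Real.exp (-9) ^ 2 / 4 by positivity))
  filter_upwards [ha, hb, hB.eventually_ge_atTop 16, hab.eventually_ge_atTop 0]
    with N ha hb hB hab
  have hN : (0 : ℝ) < N := by
    rcases N.eq_zero_or_pos with rfl | hN
    · norm_num at hB
    · exact_mod_cast hN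
  have hle : a N ≤ b N :=
    (sq_le_sq₀ ha hb.1).1 (sub_nonneg.1 (nonneg_of_mul_nonneg_right hab hN))
  exact le_variance_radialCount ha hle hb.2 hB

end QuaternionGinibre

theorem theorem8_general (a b : ℕ → ℝ) (ha : ∀ᶠ N in atTop, 0 ≤ a N)
    (hb : ∀ᶠ N in atTop, b N ∈ Set.Icc 0 1)
    (hab : Tendsto (fun N : ℕ => (N : ℝ) * (b N ^ 2 - a N ^ 2)) atTop atTop) :
    TendstoInDistribution
      (fun N : ℕ => QuaternionGinibre.normalizedRadialCount N (a N) (b N)) atTop (id : ℝ → ℝ)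
      (fun N : ℕ => QuaternionGinibre.law N) (gaussianReal 0 1) :=
  QuaternionGinibre.tendstoInDistribution_linearStatistic_norm
    (f := fun N => (Set.Icc (a N) (b N)).indicator 1)
    (fun _ => measurable_one.indicator measurableSet_Icc) (fun _ => abs_indicator_one_le _)
    (QuaternionGinibre.tendsto_variance_radialCount ha hb hab)

theorem theorem8 (a b : ℕ → ℝ) (ε : ℝ) (hε : 0 < ε)
    (ha : ∀ᶠ N in atTop, 0 ≤ a N) (hbε : ∀ᶠ N in atTop, ε ≤ b N)
    (hb : ∀ᶠ N in atTop, b N ≤ 1)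
    (hab : Tendsto (fun N : ℕ => (N : ℝ) * (b N - a N)) atTop atTop) :
    TendstoInDistribution
      (fun N : ℕ => QuaternionGinibre.normalizedRadialCount N (a N) (b N))
      atTop (id : ℝ → ℝ) (fun N : ℕ => QuaternionGinibre.law N) (gaussianReal 0 1) := by
  exact theorem8_general a b ha
    (by filter_upwards [hbε, hb] with N hεN hN using ⟨hε.le.trans hεN, hN⟩)
    (tendsto_mul_sq_sub_sq_atTop hε ha hbε hab)
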